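/- Let $D$ be a division ring with center $F$, and let $D^*=D\setminus\{0\}$ be its multiplicative group. A subgroup $H$ of a group $G$ is called almost subnormal in $G$ if there is a finite chain of subgroups $H=H_0\leq H_1\leq\cdots\leq H_r=G$ such that, for each $0\leq i\leq r-1$, either the index $[H_{i+1}:H_i]$ is finite or $H_i$ is normal in $H_{i+1}$. A subgroup of $D^*$ is called non-central if it is not contained in $F$. Then every non-central almost subnormal subgroup of $D^*$ contains a non-central subnormal subgroup of $D^*$. -/

import Mathlib

/-- A subgroup `H` of a group `G` is *almost subnormal* if there is a finite chain of subgroups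
`H = H₀ ≤ H₁ ≤ ⋯ ≤ H_r = G` such that, for each `0 ≤ i < r`, either the index `[H_{i+1} : H_i]`
is finite or `H_i` is normal in `H_{i+1}`. (The values of `c` beyond `r` are irrelevant;
`Subgroup.relIndex` is `0` exactly when the index is infinite.) -/
def Subgroup.IsAlmostSubnormal {G : Type*} [Group G] (H : Subgroup G) : Prop :=
  ∃ (r : ℕ) (c : ℕ → Subgroup G), c 0 = H ∧ c r = ⊤ ∧
    ∀ i < r, c i ≤ c (i + 1) ∧
      ((c i).relIndex (c (i + 1)) ≠ 0 ∨ ((c i).subgroupOf (c (i + 1))).Normal)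

/-- A subgroup of the multiplicative group `D^*` is *non-central* if it is not contained in the
center of `D`. -/
def Subgroup.IsNonCentral {D : Type*} [DivisionRing D] (H : Subgroup Dˣ) : Prop :=
  ¬ ∀ x ∈ H, (x : D) ∈ Subring.center D

/-!
An almost subnormal subgroup `G` of `Dˣ` contains, by pure group theory, a subgroup `N` of finite
index in `G` that is subnormal in `Dˣ`
(`Subgroup.IsAlmostSubnormal.exists_isSubnormal_relIndex_ne_zero`). If `N` were central, `G` would
be finite modulo the center, and the point is that this forces `G` to be central
(`Subgroup.IsAlmostSubnormal.le_center`).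

Let the center `k` be infinite, and suppose that `a ∈ G` is noncentral while `G` is finite modulo
the center. Since `Dˣ` is infinite modulo the center, some term `A ∋ a` of the chain is finite
modulo the center and normal in the next term `B`, which is not. As `a` has finitely many conjugates
under `B`, its centralizer in `B` has finite index in `B`, hence contains a noncentral subnormal
subgroup of `Dˣ`. This is impossible:
a subnormal subgroup `N` that commutes with a noncentral `a` is central
(`Subgroup.IsSubnormal.le_center_of_le_centralizer`). For `n ∈ N` and every `y : D`, the iterated
commutators `⁅…⁅1 + t y, n⁆…, n⁆` with `t : k` lie in `N` and so commute with `a`; they are rational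
functions of the central variable `t`, and comparing the coefficients of `t` gives
`(1 - σ_a) (1 - σ_n) ^ r = 0` on `D`, where `σ_u` is conjugation by `u`. It follows that `σ_n` is
unipotent, so if `n` is not central there is `z` with `σ_n z = z + 1`. In characteristic zero this
contradicts unipotency. In characteristic `p`, unipotency shows that a `p`-power of each element of
`N` is central, which fails for the iterated commutators `⁅…⁅z, n⁆…, n⁆`
(`unitConj_iterate_pow_ne`).

If the center is finite and `G` is finite modulo the center, then `G` is finite. A noncentral
`a ∈ G` generates a finite field, and some `w` conjugates `a` to another element of that field. By
Wedderburn's little theorem `w` has infinite order, and a power of `w` commutes with both `a` and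
`w`. In the centralizer of that power, whose center is infinite, `a` is still noncentral, and the
previous case applies.
-/

open scoped commutatorElement

/-! ### Rational functions of a central variable over a division ring -/

open Polynomial in
/-- **Right Ore condition** for polynomials over a division ring. -/
theorem Polynomial.exists_mul_eq_mul_of_divisionRing {D : Type*} [DivisionRing D] (P Q : D[X])
    (hQ : Q ≠ 0) : ∃ A B : D[X], A ≠ 0 ∧ P * A = Q * B := by
  induction h : Q.natDegree using Nat.strong_induction_on generalizing P Q with
  | _ d ih =>
    have hmon : (Q * C Q.leadingCoeff⁻¹).Monic := monic_mul_leadingCoeff_inv hQ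
    set Q' := Q * C Q.leadingCoeff⁻¹ with hQ'
    have hdiv := modByMonic_add_div P Q'
    by_cases hR : P %ₘ Q' = 0
    · refine ⟨1, C Q.leadingCoeff⁻¹ * (P /ₘ Q'), one_ne_zero, ?_⟩
      rw [hR, zero_add] at hdiv
      rw [mul_one, ← mul_assoc, ← hQ', hdiv]
    · have hdeg : (P %ₘ Q').natDegree < d := by
        have h1 := degree_modByMonic_lt P hmon
        rw [hQ', degree_mul_leadingCoeff_inv _ hQ] at h1
        exact h ▸ natDegree_lt_natDegree hR h1
      obtain ⟨A, B, hA, hAB⟩ := ih _ hdeg Q (P %ₘ Q') hR rfl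
      refine ⟨B, C Q.leadingCoeff⁻¹ * (P /ₘ Q') * B + A, ?_, ?_⟩
      · rintro rfl
        exact mul_ne_zero hQ hA (by rw [hAB, mul_zero])
      · conv_lhs => rw [← hdiv]
        rw [add_mul, ← hAB, mul_add, add_comm, hQ']
        simp only [mul_assoc]

open Polynomial in
/-- In the right Ore condition, if both polynomials have constant term `1` then the multipliers can
be chosen with constant term `1` as well. -/
theorem Polynomial.exists_mul_eq_mul_of_coeff_zero_eq_one {D : Type*} [DivisionRing D]
    {P Q : D[X]} (hP : P.coeff 0 = 1) (hQ : Q.coeff 0 = 1) :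
    ∃ A B : D[X], A.coeff 0 = 1 ∧ B.coeff 0 = 1 ∧ P * A = Q * B := by
  have hQ0 : Q ≠ 0 := by rintro rfl; simp at hQ
  obtain ⟨A, B, hA, hAB⟩ := exists_mul_eq_mul_of_divisionRing P Q hQ0
  induction h : A.natDegree using Nat.strong_induction_on generalizing A B with
  | _ d ih =>
    have h0 : A.coeff 0 = B.coeff 0 := by
      have := congrArg (fun p => p.coeff 0) hAB
      simpa [mul_coeff_zero, hP, hQ] using this
    by_cases hA0 : A.coeff 0 = 0
    · -- a common factor `X` of `A` and `B` can be cancelled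
      have eA := divX_mul_X_add A
      have eB := divX_mul_X_add B
      rw [← h0, hA0, C_0, add_zero] at eB
      rw [hA0, C_0, add_zero] at eA
      have hA' : A.divX ≠ 0 := by
        intro h'; rw [h', zero_mul] at eA; exact hA eA.symm
      refine ih _ ?_ A.divX B.divX hA' ?_ rfl
      · have := natDegree_mul_X hA'
        rw [eA, h] at this
        omega
      · rw [← eA, ← eB, ← mul_assoc, ← mul_assoc] at hAB
        exact mul_right_cancel₀ X_ne_zero hAB
    · refine ⟨A * C (A.coeff 0)⁻¹, B * C (A.coeff 0)⁻¹, ?_, ?_, ?_⟩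
      · simp [hA0]
      · simp [← h0, hA0]
      · rw [← mul_assoc, hAB, mul_assoc]

section RationalJet

open Polynomial Filter

variable {k D : Type*} [Field k] [DivisionRing D] [Algebra k D]

/-- Evaluation of a polynomial over the `k`-algebra `D` at a scalar of `k`; it is multiplicative
since scalars are central. -/
noncomputable def scalarEval (D : Type*) [DivisionRing D] [Algebra k D] (t : k) : D[X] →+* D :=
  eval₂RingHom' (RingHom.id D) (algebraMap k D t) fun a =>
    show Commute a _ from (Algebra.commutes t a).symm

theorem scalarEval_apply (t : k) (P : D[X]) :
    scalarEval D t P = P.eval₂ (RingHom.id D) (algebraMap k D t) := rfl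

theorem scalarEval_C (t : k) (a : D) : scalarEval D t (C a) = a := by
  simp [scalarEval_apply]

theorem scalarEval_X (t : k) : scalarEval D t X = algebraMap k D t := by
  simp [scalarEval_apply]

theorem scalarEval_eq_sum (t : k) (P : D[X]) :
    scalarEval D t P = P.sum fun n a => t ^ n • a := by
  simp only [scalarEval_apply, eval₂_eq_sum, RingHom.id_apply]
  refine Finset.sum_congr rfl fun n _ => ?_
  simp only [← map_pow, ← Algebra.commutes, Algebra.smul_def]

theorem scalarEval_map (σ : D →ₐ[k] D) (t : k) (P : D[X]) :
    scalarEval D t (P.map (σ : D →+* D)) = σ (scalarEval D t P) := by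
  rw [scalarEval_apply, scalarEval_apply, eval₂_map, RingHom.id_comp, eval₂_eq_sum, eval₂_eq_sum,
    Polynomial.sum, Polynomial.sum, map_sum]
  simp

/-- A nonzero polynomial over a `k`-algebra has only finitely many roots in `k`: a linear form
that does not vanish on some coefficient reduces this to polynomials over `k`. -/
theorem eventually_scalarEval_ne_zero {P : D[X]} (hP : P ≠ 0) :
    ∀ᶠ t : k in cofinite, scalarEval D t P ≠ 0 := by
  obtain ⟨n, hn⟩ : ∃ n, P.coeff n ≠ 0 := by
    by_contra! h; exact hP (Polynomial.ext (by simpa using h))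
  obtain ⟨φ, hφ⟩ : ∃ φ : Module.Dual k D, φ (P.coeff n) ≠ 0 := by
    by_contra! h; exact hn ((Module.forall_dual_apply_eq_zero_iff k _).1 h)
  set p : k[X] := ∑ i ∈ P.support, monomial i (φ (P.coeff i)) with hp
  have hp0 : p ≠ 0 := by
    intro h
    have := congrArg (fun q => q.coeff n) h
    simp [hp, coeff_monomial, hn] at this
    exact hφ this
  classical
  refine (p.roots.toFinset.finite_toSet).subset fun t ht => ?_
  have ht' : scalarEval D t P = 0 := by simpa using ht
  have : p.eval t = φ (scalarEval D t P) := by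
    rw [scalarEval_eq_sum, Polynomial.sum, map_sum, hp, eval_finsetSum]
    refine Finset.sum_congr rfl fun i _ => ?_
    simp [mul_comm]
  simp [hp0, IsRoot, this, ht']

/-- `HasRationalJet f c` says that, up to finitely many `t : k`, the function `f : k → D` is a right
quotient `P(t) Q(t)⁻¹` of polynomials over `D` in a central variable, and that the corresponding
power series is `1 + c t + O(t²)`. -/
def HasRationalJet (f : k → D) (c : D) : Prop :=
  ∃ P Q : D[X], P.coeff 0 = 1 ∧ Q.coeff 0 = 1 ∧ P.coeff 1 - Q.coeff 1 = c ∧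
    ∀ᶠ t : k in cofinite, f t * scalarEval D t Q = scalarEval D t P

theorem hasRationalJet_one_add (y : D) :
    HasRationalJet (fun t : k => 1 + algebraMap k D t * y) y := by
  refine ⟨1 + X * C y, 1, ?_, ?_, ?_, ?_⟩ <;>
    simp [coeff_one, scalarEval_C, scalarEval_X, Algebra.commutes]

theorem HasRationalJet.mul {f g : k → D} {c d : D} (hf : HasRationalJet f c)
    (hg : HasRationalJet g d) : HasRationalJet (fun t => f t * g t) (c + d) := by
  obtain ⟨P, Q, hP, hQ, rfl, h⟩ := hf
  obtain ⟨P', Q', hP', hQ', rfl, h'⟩ := hg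
  obtain ⟨A, B, hA, hB, hAB⟩ := exists_mul_eq_mul_of_coeff_zero_eq_one hP' hQ
  refine ⟨P * B, Q' * A, ?_, ?_, ?_, ?_⟩
  · simp [hP, hB]
  · simp [hQ', hA]
  · have := congrArg (fun p => p.coeff 1) hAB
    simp only [mul_coeff_one, hP', hA, hQ, hB, hP, hQ', one_mul, mul_one] at this ⊢
    rw [eq_sub_of_add_eq' this]; abel
  · filter_upwards [h, h'] with t h h'
    rw [map_mul, map_mul, mul_assoc, ← mul_assoc (g t), h', ← map_mul, hAB, map_mul, ← mul_assoc, h]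

theorem HasRationalJet.inv {f : k → D} {c : D} (hf : HasRationalJet f c) :
    HasRationalJet (fun t => (f t)⁻¹) (-c) := by
  obtain ⟨P, Q, hP, hQ, rfl, h⟩ := hf
  refine ⟨Q, P, hQ, hP, by abel, ?_⟩
  have hP0 : P ≠ 0 := by rintro rfl; simp at hP
  filter_upwards [h, eventually_scalarEval_ne_zero (k := k) hP0] with t h h'
  have : f t ≠ 0 := by
    intro h0; rw [h0, zero_mul] at h; exact h' h.symm
  rw [← h, inv_mul_cancel_left₀ this]

theorem HasRationalJet.map {f : k → D} {c : D} (hf : HasRationalJet f c) (σ : D →ₐ[k] D) :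
    HasRationalJet (fun t => σ (f t)) (σ c) := by
  obtain ⟨P, Q, hP, hQ, rfl, h⟩ := hf
  refine ⟨P.map σ, Q.map σ, by simp [hP], by simp [hQ], by simp, ?_⟩
  filter_upwards [h] with t h
  rw [scalarEval_map, scalarEval_map, ← h, map_mul]

/-- Over an infinite field of scalars, the jet of a rational function that is constantly `1`
vanishes. -/
theorem HasRationalJet.eq_zero [Infinite k] {f : k → D} {c : D} (hf : HasRationalJet f c)
    (h1 : ∀ᶠ t in cofinite, f t = 1) : c = 0 := by
  obtain ⟨P, Q, hP, hQ, rfl, h⟩ := hf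
  have : Q - P = 0 := by
    by_contra hne
    obtain ⟨t, h, h', h''⟩ := (h.and (h1.and (eventually_scalarEval_ne_zero (k := k) hne))).exists
    rw [h', one_mul] at h
    exact h'' (by rw [map_sub, h, sub_self])
  rw [← sub_eq_zero.1 this, sub_self]

end RationalJet

/-! ### Iterated commutators and unipotent conjugations -/

/-- If `N` is subnormal of defect `r`, then the `r`-fold commutator `⁅…⁅⁅x, n⁆, n⁆…, n⁆` lies in `N`
for all `n ∈ N` and all `x` in the group. -/
theorem Subgroup.IsSubnormal.exists_iterate_commutator_mem {G : Type*} [Group G] {N : Subgroup G}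
    (hN : N.IsSubnormal) : ∃ r : ℕ, ∀ n ∈ N, ∀ x : G, (fun g => ⁅g, n⁆)^[r] x ∈ N := by
  induction hN with
  | top => exact ⟨0, fun _ _ _ => Subgroup.mem_top _⟩
  | step H K h_le _ hN ih =>
    obtain ⟨r, hr⟩ := ih
    refine ⟨r + 1, fun n hn x => ?_⟩
    rw [Function.iterate_succ_apply', commutatorElement_def]
    have := hN.conj_mem ⟨n, h_le hn⟩ (by simpa [Subgroup.mem_subgroupOf] using hn)
      ⟨_, hr n (h_le hn) x⟩
    exact H.mul_mem (by simpa [Subgroup.mem_subgroupOf] using this) (H.inv_mem hn)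

section Conjugation

variable (k : Type*) {D : Type*} [Field k] [DivisionRing D] [Algebra k D]

/-- Conjugation by a unit `u`, as an endomorphism of the `k`-algebra `D`. -/
def unitConj (u : Dˣ) : D →ₐ[k] D where
  toFun x := u * x * (u⁻¹ : Dˣ)
  map_one' := by simp
  map_mul' x y := by simp [mul_assoc]
  map_zero' := by simp
  map_add' x y := by simp [mul_add, add_mul]
  commutes' r := by rw [← Algebra.commutes, mul_assoc]; simp

variable {k}

theorem unitConj_apply (u : Dˣ) (x : D) : unitConj k u x = u * x * (u⁻¹ : Dˣ) := rfl

theorem unitConj_one (x : D) : unitConj k 1 x = x := by simp [unitConj_apply]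

theorem unitConj_eq_self_iff {u : Dˣ} {x : D} : unitConj k u x = x ↔ (u : D) * x = x * u := by
  rw [unitConj_apply, Units.mul_inv_eq_iff_eq_mul]

theorem unitConj_mul (u v : Dˣ) (x : D) : unitConj k (u * v) x = unitConj k u (unitConj k v x) := by
  simp [unitConj_apply, mul_assoc]

theorem unitConj_pow_toLinearMap (u : Dˣ) (m : ℕ) :
    (unitConj k u).toLinearMap ^ m = (unitConj k (u ^ m)).toLinearMap := by
  induction m with
  | zero => ext x; simp [unitConj_apply]
  | succ m ih =>
    ext x
    rw [pow_succ, ih, pow_succ]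
    simp [unitConj_mul]

variable (k)

/-- The operator `x ↦ x - u x u⁻¹`. -/
def conjDiff (u : Dˣ) : Module.End k D := 1 - (unitConj k u).toLinearMap

variable {k}

theorem conjDiff_apply (u : Dˣ) (x : D) : conjDiff k u x = x - unitConj k u x := rfl

theorem conjDiff_apply_eq_zero_iff {u : Dˣ} {x : D} :
    conjDiff k u x = 0 ↔ (u : D) * x = x * u := by
  rw [conjDiff_apply, sub_eq_zero, eq_comm, unitConj_eq_self_iff]

theorem commute_conjDiff {u v : Dˣ} (h : Commute u v) : Commute (conjDiff k u) (conjDiff k v) := by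
  refine (Commute.one_left _).sub_left ((Commute.one_right _).sub_right ?_)
  ext x
  simp only [Module.End.mul_apply, AlgHom.toLinearMap_apply, ← unitConj_mul, h.eq]

theorem conjDiff_mul_of_eq_zero (u : Dˣ) {v : D} (hv : conjDiff k u v = 0) (x : D) :
    conjDiff k u (x * v) = conjDiff k u x * v := by
  rw [conjDiff_apply, sub_eq_zero] at hv
  rw [conjDiff_apply, conjDiff_apply, map_mul, ← hv, sub_mul]

theorem conjDiff_mul_of_eq_zero' (u : Dˣ) {v : D} (hv : conjDiff k u v = 0) (x : D) :
    conjDiff k u (v * x) = v * conjDiff k u x := by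
  rw [conjDiff_apply, sub_eq_zero] at hv
  rw [conjDiff_apply, conjDiff_apply, map_mul, ← hv, mul_sub]

theorem conjDiff_pow_mul_of_eq_zero (u : Dˣ) {v : D} (hv : conjDiff k u v = 0) (r : ℕ) (x : D) :
    (conjDiff k u ^ r) (x * v) = (conjDiff k u ^ r) x * v := by
  induction r with
  | zero => simp
  | succ r ih =>
    rw [pow_succ', Module.End.mul_apply, Module.End.mul_apply, ih, conjDiff_mul_of_eq_zero u hv]

theorem coe_commutatorElement (g n : Dˣ) :
    ((⁅g, n⁆ : Dˣ) : D) = g * (unitConj k n g)⁻¹ := by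
  rw [commutatorElement_def, unitConj_apply]
  simp [mul_assoc]

theorem coe_iterate_commutatorElement (n x : Dˣ) (r : ℕ) :
    (((fun g => ⁅g, n⁆)^[r] x : Dˣ) : D) = (fun y : D => y * (unitConj k n y)⁻¹)^[r] x := by
  induction r with
  | zero => rfl
  | succ r ih => rw [Function.iterate_succ_apply', Function.iterate_succ_apply',
      coe_commutatorElement (k := k), ih]

theorem hasRationalJet_iterate (n : Dˣ) (y : D) (r : ℕ) :
    HasRationalJet (fun t : k => (fun x : D => x * (unitConj k n x)⁻¹)^[r]
      (1 + algebraMap k D t * y)) ((conjDiff k n ^ r) y) := by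
  induction r with
  | zero => exact hasRationalJet_one_add y
  | succ r ih =>
    have := ih.mul (ih.map (unitConj k n)).inv
    rw [pow_succ', Module.End.mul_apply, conjDiff_apply, sub_eq_add_neg]
    simpa only [Function.iterate_succ_apply'] using this

open Filter Polynomial in
/-- The linear identity obtained by differentiating, at `t = 0`, the relation that the iterated
commutator `⁅…⁅1 + t y, n⁆…, n⁆` commutes with `a`. -/
theorem conjDiff_conjDiff_pow_eq_zero [Infinite k] {a n : Dˣ} {r : ℕ}
    (h : ∀ x : Dˣ, Commute a ((fun g => ⁅g, n⁆)^[r] x)) (y : D) :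
    conjDiff k a ((conjDiff k n ^ r) y) = 0 := by
  have hjet := hasRationalJet_iterate (k := k) n y r
  have := hjet.mul (hjet.map (unitConj k a)).inv
  rw [conjDiff_apply, sub_eq_add_neg]
  refine this.eq_zero ?_
  have hne : (1 + X * C y : D[X]) ≠ 0 := by
    intro h0
    have := congrArg (fun p => p.coeff 0) h0
    simp at this
  filter_upwards [eventually_scalarEval_ne_zero (k := k) hne] with t ht
  rw [map_add, map_one, map_mul, scalarEval_X, scalarEval_C] at ht
  set x : Dˣ := Units.mk0 _ ht
  have hx : (1 + algebraMap k D t * y) = (x : D) := rfl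
  have hc : unitConj k a (((fun g => ⁅g, n⁆)^[r] x : Dˣ) : D) =
      (((fun g => ⁅g, n⁆)^[r] x : Dˣ) : D) :=
    unitConj_eq_self_iff.2 (by exact_mod_cast congrArg (Units.val) (h x).eq)
  rw [hx, ← coe_iterate_commutatorElement, hc, mul_inv_cancel₀ (Units.ne_zero _)]

/-- If conjugation by `n` is unipotent on the image of `x ↦ x - a x a⁻¹`, where `a` is noncentral
and commutes with `n`, then it is unipotent on all of `D`. -/
theorem conjDiff_pow_eq_zero {a n : Dˣ} {r : ℕ} (han : Commute a n)
    (ha : ∃ y : D, (a : D) * y ≠ y * a)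
    (h : ∀ y : D, conjDiff k a ((conjDiff k n ^ r) y) = 0) : conjDiff k n ^ (r + r) = 0 := by
  have hcomm (j : ℕ) (y : D) :
      conjDiff k a ((conjDiff k n ^ j) y) = (conjDiff k n ^ j) (conjDiff k a y) :=
    LinearMap.congr_fun ((commute_conjDiff han).pow_right j).eq y
  obtain ⟨u, hu⟩ : ∃ u, conjDiff k a u ≠ 0 := by
    obtain ⟨u, hu⟩ := ha
    exact ⟨u, fun h => hu (conjDiff_apply_eq_zero_iff.1 h)⟩
  -- replace `u` so that the value `conjDiff k a u` is moreover fixed by `n`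
  obtain ⟨u, hu, hu'⟩ : ∃ u, conjDiff k a u ≠ 0 ∧ conjDiff k n (conjDiff k a u) = 0 := by
    classical
    have hex : ∃ j, (conjDiff k n ^ j) (conjDiff k a u) = 0 := ⟨r, by rw [← hcomm, h]⟩
    obtain ⟨j, hj⟩ : ∃ j, Nat.find hex = j + 1 := Nat.exists_eq_succ_of_ne_zero fun h0 => by
      have := Nat.find_spec hex
      rw [h0] at this
      exact hu (by simpa using this)
    refine ⟨(conjDiff k n ^ j) u, ?_, ?_⟩
    · rw [hcomm]; exact Nat.find_min hex (by omega)
    · rw [hcomm, ← Module.End.mul_apply, ← pow_succ', ← hj]; exact Nat.find_spec hex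
  ext y
  rw [pow_add, Module.End.mul_apply]
  set c := (conjDiff k n ^ r) y
  have hc : conjDiff k a c = 0 := h y
  have := hcomm r (c * u)
  rw [h, conjDiff_mul_of_eq_zero' a hc, conjDiff_pow_mul_of_eq_zero n hu'] at this
  simpa [hu] using this.symm

/-- If conjugation by a noncentral `n` is unipotent, then it acts as a translation `z ↦ z + 1` on
some element. -/
theorem exists_unitConj_eq_add_one {n : Dˣ} {s : ℕ} (hs : conjDiff k n ^ s = 0)
    (hn : ∃ y : D, (n : D) * y ≠ y * n) : ∃ z : D, unitConj k n z = z + 1 := by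
  classical
  obtain ⟨y, hy⟩ := hn
  have hy1 : conjDiff k n y ≠ 0 := fun h => hy (conjDiff_apply_eq_zero_iff.1 h)
  have hex : ∃ j, (conjDiff k n ^ j) (conjDiff k n y) = 0 := ⟨s, by simp [hs]⟩
  obtain ⟨j, hj⟩ : ∃ j, Nat.find hex = j + 1 := Nat.exists_eq_succ_of_ne_zero fun h0 => by
    have := Nat.find_spec hex
    rw [h0] at this
    exact hy1 (by simpa using this)
  have h1 : (conjDiff k n ^ j) (conjDiff k n y) ≠ 0 := Nat.find_min hex (by omega)
  have h2 : conjDiff k n ((conjDiff k n ^ j) (conjDiff k n y)) = 0 := by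
    rw [← Module.End.mul_apply, ← pow_succ', ← hj]; exact Nat.find_spec hex
  set v := (conjDiff k n ^ j) (conjDiff k n y) with hv
  have hw : conjDiff k n ((conjDiff k n ^ j) y) = v := by
    rw [hv, ← Module.End.mul_apply, ← pow_succ', pow_succ, Module.End.mul_apply]
  have hvinv : conjDiff k n v⁻¹ = 0 := by
    rw [conjDiff_apply, sub_eq_zero] at h2 ⊢
    rw [map_inv₀, ← h2]
  -- `v⁻¹ * w` satisfies `x - n x n⁻¹ = 1` when `w - n w n⁻¹ = v` is fixed by `n`
  refine ⟨-(v⁻¹ * (conjDiff k n ^ j) y), ?_⟩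
  have := conjDiff_mul_of_eq_zero' n hvinv ((conjDiff k n ^ j) y)
  rw [hw, inv_mul_cancel₀ h1, conjDiff_apply, sub_eq_iff_eq_add] at this
  rw [map_neg]
  nth_rewrite 2 [this]
  abel

/-- In characteristic zero, conjugation by an element that acts as `z ↦ z + 1` on some `z` is not
unipotent. -/
theorem conjDiff_pow_ne_zero_of_charZero [CharZero D] {n : Dˣ} {z : D}
    (hz : unitConj k n z = z + 1) (s : ℕ) : conjDiff k n ^ s ≠ 0 := by
  -- if the left side and the first term on the right vanish identically, then so does the power
  -- with exponent `j`, which allows a descent on the index of nilpotency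
  have key (j : ℕ) (w : D) : (conjDiff k n ^ (j + 1)) (w * z) =
      (conjDiff k n ^ (j + 1)) w * (z + (j + 1 : ℕ)) - (j + 1 : ℕ) * (conjDiff k n ^ j) w := by
    induction j generalizing w with
    | zero => simp [conjDiff_apply, hz]; noncomm_ring
    | succ j ih =>
      have h1 : conjDiff k n (w * z) = conjDiff k n w * (z + 1) - w := by
        simp [conjDiff_apply, hz]; noncomm_ring
      have h2 (j : ℕ) : (conjDiff k n ^ j) (conjDiff k n w) = (conjDiff k n ^ (j + 1)) w := by
        rw [pow_succ, Module.End.mul_apply]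
      rw [pow_succ, Module.End.mul_apply, h1, mul_add, mul_one, map_sub, map_add, ih, h2, h2]
      rw [← h2 (j + 1)]
      push_cast
      rw [h2]
      noncomm_ring
  induction s with
  | zero => simp
  | succ s ih =>
    intro h
    apply ih
    ext w
    have := key s w
    rw [h] at this
    have h0 : ((s + 1 : ℕ) : D) ≠ 0 := Nat.cast_ne_zero.2 (by omega)
    simpa [h0, -Nat.cast_add] using this.symm

/-- In characteristic `p`, if conjugation by `n` is unipotent then some `p`-power of `n` is
central; the exponent depends only on the index of nilpotency. -/
theorem pow_char_pow_mul_comm {p : ℕ} [Fact p.Prime] [CharP D p] {n : Dˣ} {s e : ℕ}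
    (hs : conjDiff k n ^ s = 0) (he : s ≤ p ^ e) (y : D) :
    (n : D) ^ p ^ e * y = y * (n : D) ^ p ^ e := by
  have : CharP k p := (RingHom.charP_iff _ (algebraMap k D).injective p).2 inferInstance
  have : CharP (Module.End k D) p :=
    charP_of_injective_algebraMap (algebraMap k (Module.End k D)).injective p
  have h : conjDiff k (n ^ p ^ e) = 0 := by
    rw [← pow_eq_zero_of_le he hs]
    conv_rhs => rw [conjDiff, sub_pow_char_pow_of_commute _ _ (Commute.one_left _), one_pow,
      unitConj_pow_toLinearMap]
    rfl
  have := LinearMap.congr_fun h y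
  rw [LinearMap.zero_apply, conjDiff_apply_eq_zero_iff] at this
  simpa using this

end Conjugation

/-! ### Subnormal subgroups commuting with a noncentral element -/

section Unipotent

variable {k D : Type*} [Field k] [DivisionRing D] [Algebra k D]

/-- In characteristic `p`, let conjugation by `n` act on `z` as `z ↦ z + 1`. Then no `p`-power of
an iterated commutator `⁅…⁅z, n⁆…, n⁆` commutes with `n`. On the commutative double centralizer of
`z` conjugation by `n` has order `p`, so that an element `c` fixed by it and of the form
`g (n g n⁻¹)⁻¹` satisfies `c ^ p = 1`, that is, `c = 1`. -/
theorem unitConj_iterate_pow_ne {p : ℕ} [Fact p.Prime] [CharP D p] {n : Dˣ} {z : D}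
    (hz : unitConj k n z = z + 1) (e j : ℕ) :
    unitConj k n ((fun x : D => x * (unitConj k n x)⁻¹)^[j] z ^ p ^ e) ≠
      (fun x : D => x * (unitConj k n x)⁻¹)^[j] z ^ p ^ e := by
  set g : ℕ → D := fun j => (fun x : D => x * (unitConj k n x)⁻¹)^[j] z with hg
  have hg0 : g 0 = z := rfl
  have hgs (j) : g (j + 1) = g j * (unitConj k n (g j))⁻¹ := Function.iterate_succ_apply' _ _ _
  have hz0 : z ≠ 0 := by rintro rfl; simp at hz
  have hgne (j) : g j ≠ 0 := by
    induction j with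
    | zero => exact hz0
    | succ j ih =>
      rw [hgs]
      exact mul_ne_zero ih (inv_ne_zero ((map_ne_zero (unitConj k n)).2 ih))
  -- the double centralizer of `z` is commutative, stable under conjugation by `n`, and fixed
  -- pointwise by conjugation by `n ^ p`
  let L : Set D := {x | ∀ y, Commute y z → Commute y x}
  have hLcomm {x y : D} (hx : x ∈ L) (hy : y ∈ L) : Commute x y :=
    hy x (hx z (Commute.refl z)).symm
  have hLσ {x : D} (hx : x ∈ L) : unitConj k n x ∈ L := by
    intro y hy
    have h1 : Commute (unitConj k n⁻¹ y) z := by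
      have h2 : unitConj k n⁻¹ z = z - 1 := by
        have := congrArg (unitConj k n⁻¹) hz
        rw [← unitConj_mul, inv_mul_cancel, map_add, map_one, unitConj_one] at this
        exact eq_sub_of_add_eq this.symm
      have h3 : Commute (unitConj k n⁻¹ y) (z - 1) := h2 ▸ hy.map (unitConj k n⁻¹)
      simpa using h3.add_right (Commute.one_right _)
    have h4 := (hx _ h1).map (unitConj k n)
    rwa [← unitConj_mul, mul_inv_cancel, unitConj_one] at h4
  have hLg (j) : g j ∈ L := by
    induction j with
    | zero => exact fun y hy => hy
    | succ j ih =>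
      intro y hy
      rw [hgs]
      exact (ih y hy).mul_right ((hLσ ih) y hy).inv_right₀
  have hzi (i : ℕ) : unitConj k (n ^ i) z = z + i := by
    induction i with
    | zero => simp [unitConj_apply]
    | succ i ih => rw [pow_succ, unitConj_mul, hz, map_add, map_one, ih]; push_cast; abel
  have hLp {x : D} (hx : x ∈ L) : unitConj k (n ^ p) x = x := by
    rw [unitConj_eq_self_iff]
    refine hx _ ?_
    have := hzi p
    rwa [CharP.cast_eq_zero, add_zero, unitConj_eq_self_iff] at this
  change unitConj k n (g j ^ p ^ e) ≠ g j ^ p ^ e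
  induction j with
  | zero =>
    rw [hg0, map_pow, hz, add_pow_char_pow_of_commute _ _ (Commute.one_right z), one_pow]
    simp
  | succ j ih =>
    intro hc
    refine ih ?_
    have hG : g (j + 1) ^ p ^ e = g j ^ p ^ e * (unitConj k n (g j ^ p ^ e))⁻¹ := by
      rw [hgs, (hLcomm (hLg j) (hLσ (hLg j))).inv_right₀.mul_pow, inv_pow, map_pow]
    have hGne : g j ^ p ^ e ≠ 0 := pow_ne_zero _ (hgne j)
    set G := g j ^ p ^ e with hGdef
    set c := g (j + 1) ^ p ^ e
    have hσG : unitConj k n G ≠ 0 := (map_ne_zero (unitConj k n)).2 hGne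
    have h1 : G = c * unitConj k n G := by rw [hG, inv_mul_cancel_right₀ hσG]
    have h2 (i : ℕ) : G = c ^ i * unitConj k (n ^ i) G := by
      induction i with
      | zero => simp [unitConj_apply]
      | succ i ih =>
        rw [pow_succ' n, unitConj_mul, pow_succ' c, mul_assoc]
        conv_lhs => rw [h1, ih, map_mul, map_pow, hc]
    have h3 : c ^ p = 1 := by
      have h4 := h2 p
      rw [hGdef, map_pow, hLp (hLg j), ← hGdef] at h4
      exact (mul_eq_right₀ hGne).1 h4.symm
    have h4 : c = 1 := by
      have : (c - 1) ^ p = 0 := by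
        rw [sub_pow_char_of_commute _ (Commute.one_right c), h3, one_pow, sub_self]
      exact sub_eq_zero.1 (pow_eq_zero_iff (Fact.out : p.Prime).ne_zero |>.1 this)
    rw [h4, one_mul] at h1
    exact h1.symm

/-- In a division algebra over an infinite field, a subnormal subgroup of the multiplicative group
that commutes with a noncentral element is central. -/
theorem Subgroup.IsSubnormal.le_center_of_le_centralizer [Infinite k] {N : Subgroup Dˣ}
    (hN : N.IsSubnormal) {a : Dˣ} (ha : a ∉ Subgroup.center Dˣ)
    (haN : N ≤ Subgroup.centralizer {a}) : N ≤ Subgroup.center Dˣ := by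
  have hcentral {u : Dˣ} (hu : u ∉ Subgroup.center Dˣ) : ∃ y : D, (u : D) * y ≠ y * u := by
    by_contra! h
    exact hu (Subgroup.mem_center_iff.2 fun v => Units.ext (by simpa using (h v).symm))
  obtain ⟨r, hr⟩ := hN.exists_iterate_commutator_mem
  have hcomm {n : Dˣ} (hn : n ∈ N) : Commute a n :=
    (Subgroup.mem_centralizer_singleton_iff.1 (haN hn)).symm
  have hnil {n : Dˣ} (hn : n ∈ N) : conjDiff k n ^ (r + r) = 0 :=
    conjDiff_pow_eq_zero (hcomm hn) (hcentral ha)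
      (conjDiff_conjDiff_pow_eq_zero fun x => hcomm (hr n hn x))
  intro n hn
  by_contra hnc
  obtain ⟨z, hz⟩ := exists_unitConj_eq_add_one (hnil hn) (hcentral hnc)
  obtain ⟨p, hp⟩ := CharP.exists D
  rcases CharP.char_is_prime_or_zero D p with hprime | rfl
  · have : Fact p.Prime := ⟨hprime⟩
    have hz0 : z ≠ 0 := by rintro rfl; simp at hz
    refine unitConj_iterate_pow_ne hz (r + r) r (unitConj_eq_self_iff.2 ?_)
    have := pow_char_pow_mul_comm (hnil (hr n hn (Units.mk0 z hz0)))
      (Nat.lt_pow_self hprime.one_lt).le (n : D)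
    rw [coe_iterate_commutatorElement (k := k), Units.val_mk0] at this
    exact this.symm
  · have := CharP.charP_to_charZero D
    exact conjDiff_pow_ne_zero_of_charZero hz _ (hnil hn)

end Unipotent

/-! ### Almost subnormal subgroups, and division rings with infinite center -/

section GroupTheory

variable {G : Type*} [Group G]

/-- An almost subnormal subgroup contains a subnormal subgroup as a subgroup of finite index: going
down the chain, each step of finite index is replaced by the normal core. -/
theorem Subgroup.IsAlmostSubnormal.exists_isSubnormal_relIndex_ne_zero {H : Subgroup G}
    (hH : H.IsAlmostSubnormal) : ∃ N ≤ H, N.IsSubnormal ∧ N.relIndex H ≠ 0 := by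
  obtain ⟨r, c, rfl, hr, hc⟩ := hH
  have key (j : ℕ) (hj : j ≤ r) :
      ∃ N ≤ c (r - j), N.IsSubnormal ∧ N.relIndex (c (r - j)) ≠ 0 := by
    induction j with
    | zero => exact ⟨⊤, by simp [hr], .top, by simp⟩
    | succ j ih =>
      obtain ⟨N, hN, hNs, hNi⟩ := ih (by omega)
      obtain ⟨hle, hstep⟩ := hc (r - (j + 1)) (by omega)
      rw [show r - (j + 1) + 1 = r - j by omega] at hle hstep
      set A := c (r - (j + 1))
      set B := c (r - j)
      obtain ⟨K, hKA, hK, hKi⟩ :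
          ∃ K ≤ A, (K.subgroupOf B).Normal ∧ K.relIndex A ≠ 0 := by
        rcases hstep with hfin | hnorm
        · have : (A.subgroupOf B).FiniteIndex := ⟨hfin⟩
          refine ⟨(A.subgroupOf B).normalCore.map B.subtype, ?_, ?_, ?_⟩
          · rw [Subgroup.map_le_iff_le_comap]
            exact (A.subgroupOf B).normalCore_le
          · rw [Subgroup.subgroupOf, Subgroup.comap_map_eq_self_of_injective B.subtype_injective]
            infer_instance
          · intro h0
            have h1 := Subgroup.relIndex_eq_zero_of_le_right hle h0
            rw [Subgroup.relIndex, Subgroup.subgroupOf,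
              Subgroup.comap_map_eq_self_of_injective B.subtype_injective] at h1
            exact Subgroup.FiniteIndex.index_ne_zero h1
        · exact ⟨A, le_rfl, hnorm, by simp⟩
      refine ⟨N ⊓ K, inf_le_right.trans hKA, ?_, ?_⟩
      · refine .step _ N inf_le_left hNs ⟨fun x hx g => ?_⟩
        have := hK.conj_mem ⟨x, hN x.2⟩ (by
          simpa [Subgroup.mem_subgroupOf] using (Subgroup.mem_inf.1 hx).2) ⟨g, hN g.2⟩
        exact Subgroup.mem_inf.2 ⟨(g * x * g⁻¹).2, by simpa [Subgroup.mem_subgroupOf] using this⟩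
      · exact Subgroup.relIndex_inf_ne_zero
          (fun h0 => hNi (Subgroup.relIndex_eq_zero_of_le_right hle h0)) hKi
  simpa using key r le_rfl

theorem Subgroup.IsAlmostSubnormal.comap {G' : Type*} [Group G'] {H : Subgroup G}
    (hH : H.IsAlmostSubnormal) (f : G' →* G) : (H.comap f).IsAlmostSubnormal := by
  obtain ⟨r, c, rfl, hr, hc⟩ := hH
  refine ⟨r, fun i => (c i).comap f, rfl, by simp [hr], fun i hi => ?_⟩
  obtain ⟨hle, h⟩ := hc i hi
  refine ⟨Subgroup.comap_mono hle, h.imp (Subgroup.relIndex_comap_ne_zero f) fun hn => ⟨?_⟩⟩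
  intro x hx g
  have := hn.conj_mem ⟨f x, x.2⟩ (by simpa [Subgroup.mem_subgroupOf] using hx) ⟨f g, g.2⟩
  simpa [Subgroup.mem_subgroupOf] using this

theorem Subgroup.relIndex_centralizer_ne_zero {B : Subgroup G} {a : G}
    (h : {x | ∃ b ∈ B, x = b * a * b⁻¹}.Finite) : (Subgroup.centralizer {a}).relIndex B ≠ 0 := by
  let _ : MulAction B G := MulAction.compHom G (MulAut.conj.comp B.subtype)
  have hsmul (b : B) (x : G) : b • x = b * x * (b : G)⁻¹ := rfl
  have hstab : (Subgroup.centralizer {a}).subgroupOf B = MulAction.stabilizer B a := by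
    ext b
    rw [Subgroup.mem_subgroupOf, Subgroup.mem_centralizer_singleton_iff, MulAction.mem_stabilizer_iff,
      hsmul, mul_inv_eq_iff_eq_mul]
  rw [Subgroup.relIndex, hstab, MulAction.index_stabilizer]
  have hfin : (MulAction.orbit B a).Finite := by
    refine h.subset ?_
    rintro _ ⟨b, rfl⟩
    exact ⟨b, b.2, rfl⟩
  exact (Set.ncard_pos hfin).2 (MulAction.nonempty_orbit a) |>.ne'

/-- If `A` is finite modulo the center of `G` and normalized by `B`, and the center has only
finitely many elements of each exponent, then each element of `A` has finitely many conjugates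
under `B`. -/
theorem Subgroup.finite_conj_of_relIndex_center_ne_zero {A B : Subgroup G}
    (hA : (Subgroup.center G).relIndex A ≠ 0) (hAB : A ≤ B) (hn : (A.subgroupOf B).Normal)
    (hroots : ∀ m : ℕ, 0 < m → {c | c ∈ Subgroup.center G ∧ c ^ m = 1}.Finite) {a : G}
    (ha : a ∈ A) : {x | ∃ b ∈ B, x = b * a * b⁻¹}.Finite := by
  obtain ⟨m, hm, -, hma⟩ := Subgroup.exists_pow_mem_of_relIndex_ne_zero hA ha
  have hma := (Subgroup.mem_inf.1 hma).1
  have hpow {b : G} : (b * a * b⁻¹) ^ m = a ^ m := by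
    rw [conj_pow, Subgroup.mem_center_iff.1 hma, mul_inv_cancel_right]
  refine Set.Finite.of_finite_fibers (QuotientGroup.mk' (Subgroup.center G)) ?_ ?_
  · have : Finite (A.map (QuotientGroup.mk' (Subgroup.center G))) := by
      rw [← QuotientGroup.ker_mk' (Subgroup.center G), Subgroup.relIndex_ker] at hA
      exact Nat.finite_of_card_ne_zero hA
    refine (Set.toFinite (A.map (QuotientGroup.mk' (Subgroup.center G)) : Set _)).subset ?_
    rintro _ ⟨_, ⟨b, hb, rfl⟩, rfl⟩
    have := hn.conj_mem ⟨a, hAB ha⟩ (by simpa [Subgroup.mem_subgroupOf] using ha) ⟨b, hb⟩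
    exact ⟨_, by simpa [Subgroup.mem_subgroupOf] using this, rfl⟩
  · rintro _ ⟨t₀, ⟨b₀, -, ht₀⟩, rfl⟩
    refine ((hroots m hm).image (t₀ * ·)).subset ?_
    rintro t ⟨⟨b, -, ht⟩, htt⟩
    have hz : t₀⁻¹ * t ∈ Subgroup.center G := QuotientGroup.eq.1 (Eq.symm htt)
    refine ⟨t₀⁻¹ * t, ⟨hz, ?_⟩, by simp⟩
    have h1 : t = t₀ * (t₀⁻¹ * t) := by simp
    have h2 : t ^ m = t₀ ^ m * (t₀⁻¹ * t) ^ m := by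
      conv_lhs => rw [h1]
      exact Commute.mul_pow (Subgroup.mem_center_iff.1 hz t₀) m
    rw [ht, ht₀, hpow, hpow] at h2
    rw [ht, ht₀]
    exact mul_eq_left.1 h2.symm

end GroupTheory

section InfiniteCenter

variable {D : Type*} [DivisionRing D]

theorem Units.mem_center_iff_coe_mem {u : Dˣ} :
    u ∈ Subgroup.center Dˣ ↔ (u : D) ∈ Subring.center D := by
  rw [Subgroup.mem_center_iff, Subring.mem_center_iff]
  refine ⟨fun h y => ?_, fun h v => Units.ext (by simpa using h v)⟩
  rcases eq_or_ne y 0 with rfl | hy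
  · simp
  · simpa using congrArg Units.val (h (Units.mk0 y hy))

theorem Subgroup.isNonCentral_iff {H : Subgroup Dˣ} :
    H.IsNonCentral ↔ ¬ H ≤ Subgroup.center Dˣ := by
  simp only [Subgroup.IsNonCentral, SetLike.le_def, Units.mem_center_iff_coe_mem]

theorem Units.finite_center_pow_eq_one (m : ℕ) (hm : 0 < m) :
    {c : Dˣ | c ∈ Subgroup.center Dˣ ∧ c ^ m = 1}.Finite := by
  classical
  refine Set.Finite.of_finite_image (f := Units.val) ?_ Units.val_injective.injOn
  refine ((Polynomial.nthRoots m (1 : Subring.center D)).toFinset.finite_toSet.image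
    Subtype.val).subset ?_
  rintro _ ⟨c, ⟨hc, hcm⟩, rfl⟩
  refine ⟨⟨c, Units.mem_center_iff_coe_mem.1 hc⟩, ?_, rfl⟩
  simp only [Finset.mem_coe, Multiset.mem_toFinset, Polynomial.mem_nthRoots hm]
  exact Subtype.ext (by simpa using congrArg Units.val hcm)

/-- If `x` is not central, then the elements `x + t`, with `t` in the center, are pairwise
distinct modulo the central units. -/
theorem Units.index_center_eq_zero [Infinite (Subring.center D)] {x : D}
    (hx : x ∉ Subring.center D) : (Subgroup.center Dˣ).index = 0 := by
  by_contra h0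
  have : Finite (Dˣ ⧸ Subgroup.center Dˣ) := Nat.finite_of_card_ne_zero h0
  have hne (t : Subring.center D) : x + t ≠ 0 := fun h =>
    hx (by rw [eq_neg_of_add_eq_zero_left h]; exact neg_mem t.2)
  obtain ⟨s, t, hst, heq⟩ := Finite.exists_ne_map_eq_of_infinite
    fun t : Subring.center D => (Units.mk0 _ (hne t) : Dˣ ⧸ Subgroup.center Dˣ)
  have hc := Units.mem_center_iff_coe_mem.1 (QuotientGroup.eq.1 heq)
  obtain ⟨c, hcdef⟩ : ∃ c : D, c = (x + s)⁻¹ * (x + t) := ⟨_, rfl⟩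
  have hc : c ∈ Subring.center D := by simpa [hcdef] using hc
  have hmul : (x + s) * c = x + t := by rw [hcdef, mul_inv_cancel_left₀ (hne s)]
  have hc1 : 1 - c ≠ 0 := by
    intro h
    rw [← sub_eq_zero.1 h, mul_one, add_right_inj] at hmul
    exact hst (Subtype.ext hmul)
  have hxe : x = (s * c - t) * (1 - c)⁻¹ := by
    rw [eq_mul_inv_iff_mul_eq₀ hc1, mul_sub, mul_one, sub_eq_sub_iff_add_eq_add, ← hmul, add_mul,
      add_comm]
  refine hx (Subring.mem_center_iff.2 fun y => ?_)
  have hcy : Commute y c := Subring.mem_center_iff.1 hc y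
  have hsy : Commute y s := Subring.mem_center_iff.1 s.2 y
  have hty : Commute y t := Subring.mem_center_iff.1 t.2 y
  rw [hxe]
  exact ((hsy.mul_right hcy).sub_right hty).mul_right
    ((Commute.one_right y).sub_right hcy).inv_right₀

/-- When the center of `D` is infinite, an almost subnormal subgroup of `Dˣ` that is finite modulo
the center is central. -/
theorem Subgroup.IsAlmostSubnormal.le_center_of_infinite_center [Infinite (Subring.center D)]
    {H : Subgroup Dˣ} (hH : H.IsAlmostSubnormal) (hfin : (Subgroup.center Dˣ).relIndex H ≠ 0) :
    H ≤ Subgroup.center Dˣ := by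
  by_contra hnc
  obtain ⟨a, haH, ha⟩ := SetLike.not_le_iff_exists.1 hnc
  obtain ⟨r, c, rfl, hr, hc⟩ := hH
  have hle (i : ℕ) (hi : i ≤ r) : c 0 ≤ c i := by
    induction i with
    | zero => exact le_rfl
    | succ i ih => exact (ih (by omega)).trans (hc i (by omega)).1
  -- the last term of the chain that is finite modulo the center
  obtain ⟨i, hi, hAfin, hBfin⟩ : ∃ i < r, (Subgroup.center Dˣ).relIndex (c i) ≠ 0 ∧
      (Subgroup.center Dˣ).relIndex (c (i + 1)) = 0 := by
    by_contra! h
    have (i : ℕ) (hi : i ≤ r) : (Subgroup.center Dˣ).relIndex (c i) ≠ 0 := by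
      induction i with
      | zero => exact hfin
      | succ i ih => exact h i (by omega) (ih (by omega))
    have := this r le_rfl
    rw [hr, Subgroup.relIndex_top_right] at this
    exact this (Units.index_center_eq_zero fun h => ha (Units.mem_center_iff_coe_mem.2 h))
  obtain ⟨hAB, hstep⟩ := hc i hi
  rcases hstep with h | hn
  · exact Subgroup.relIndex_ne_zero_trans hAfin h hBfin
  have haA : a ∈ c i := hle i hi.le haH
  have hC := Subgroup.relIndex_centralizer_ne_zero
    (Subgroup.finite_conj_of_relIndex_center_ne_zero hAfin hAB hn Units.finite_center_pow_eq_one haA)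
  have hB : (c (i + 1)).IsAlmostSubnormal := by
    refine ⟨r - (i + 1), fun j => c (i + 1 + j), rfl, ?_, fun j hj => hc _ (by omega)⟩
    change c (i + 1 + (r - (i + 1))) = ⊤
    rw [Nat.add_sub_cancel' (by omega), hr]
  -- the centralizer of `a` in `c (i + 1)` is almost subnormal: prepend it to the rest of the chain
  obtain ⟨N, hNB, hNs, hNi⟩ :=
    Subgroup.IsAlmostSubnormal.exists_isSubnormal_relIndex_ne_zero
      (H := Subgroup.centralizer {a} ⊓ c (i + 1)) (by
        obtain ⟨s, d, hd0, hs, hd⟩ := hB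
        refine ⟨s + 1, fun j => j.casesOn (Subgroup.centralizer {a} ⊓ c (i + 1)) d, rfl, hs, ?_⟩
        rintro (_ | j) hj
        · refine ⟨by simp [hd0], .inl ?_⟩
          change (_ ⊓ _ : Subgroup Dˣ).relIndex (d 0) ≠ 0
          rwa [hd0, Subgroup.inf_relIndex_right]
        · exact hd j (by omega))
  have hNc := hNs.le_center_of_le_centralizer (k := Subring.center D) ha
    (hNB.trans inf_le_left)
  have h1 : N.relIndex (c (i + 1)) ≠ 0 :=
    Subgroup.relIndex_ne_zero_trans hNi (by rwa [Subgroup.inf_relIndex_right])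
  exact h1 (Subgroup.relIndex_eq_zero_of_le_left hNc hBfin)

end InfiniteCenter

/-! ### Division rings with finite center -/

section FiniteCenter

/-- If `E` is a finite field mapping to a division ring `D`, right multiplication by a noncentral
element of `E` has another eigenvalue in `E`, since it satisfies the split equation `X ^ q = X`. -/
theorem exists_mul_eq_mul_ne_of_finite {E D : Type*} [Field E] [Finite E] [DivisionRing D]
    (ι : E →+* D) {a : E} {y : D} (hay : y * ι a ≠ ι a * y) :
    ∃ e ≠ a, ∃ w ≠ (0 : D), w * ι a = ι e * w := by
  classical
  cases nonempty_fintype E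
  let _ : Module E D := Module.compHom D ι
  have hsmul (e : E) (y : D) : e • y = ι e * y := rfl
  let R : Module.End E D :=
    { toFun := fun y => y * ι a
      map_add' := fun x y => add_mul x y _
      map_smul' := fun e y => by simp [hsmul, mul_assoc] }
  have hR (y : D) : R y = y * ι a := rfl
  have hRpow (n : ℕ) (y : D) : (R ^ n) y = y * ι a ^ n := by
    induction n with
    | zero => simp
    | succ n ih => rw [pow_succ', Module.End.mul_apply, ih, hR, pow_succ, mul_assoc]
  by_contra! hcon
  have hinj (s : Finset E) (hs : a ∉ s) (w : D)
      (hw : Polynomial.aeval R (∏ e ∈ s, (Polynomial.X - Polynomial.C e)) w = 0) : w = 0 := by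
    induction s using Finset.induction_on generalizing w with
    | empty => simpa using hw
    | insert e s hes ih =>
      rw [Finset.prod_insert hes, map_mul, Module.End.mul_apply] at hw
      refine ih (fun h => hs (Finset.mem_insert_of_mem h)) w ?_
      by_contra hne
      refine hcon e (fun h => hs (h ▸ Finset.mem_insert_self e s)) _ hne ?_
      rw [map_sub, Polynomial.aeval_X, Polynomial.aeval_C, LinearMap.sub_apply, hR,
        Module.algebraMap_end_apply, hsmul, sub_eq_zero] at hw
      exact hw
  have hprod : ∏ e : E, (Polynomial.X - Polynomial.C e) =
      (Polynomial.X ^ Fintype.card E - Polynomial.X : Polynomial E) := by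
    have hroots := FiniteField.roots_X_pow_card_sub_X E
    have hmonic : (Polynomial.X ^ Fintype.card E - Polynomial.X : Polynomial E).Monic :=
      Polynomial.monic_X_pow_sub (by simpa using Fintype.one_lt_card)
    rw [← Polynomial.prod_multiset_X_sub_C_of_monic_of_roots_card_eq hmonic, hroots]
    · rfl
    · rw [hroots, FiniteField.X_pow_card_sub_X_natDegree_eq E Fintype.one_lt_card]
      rfl
  refine hay (sub_eq_zero.1 (hinj (Finset.univ.erase a) (by simp) _ ?_))
  have h1 : y * ι a - ι a * y = Polynomial.aeval R (Polynomial.X - Polynomial.C a) y := by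
    rw [map_sub, Polynomial.aeval_X, Polynomial.aeval_C, LinearMap.sub_apply, hR,
      Module.algebraMap_end_apply, hsmul]
  rw [h1, ← Module.End.mul_apply, ← map_mul, Finset.prod_erase_mul _ _ (Finset.mem_univ a), hprod,
    map_sub, map_pow, Polynomial.aeval_X, LinearMap.sub_apply, hRpow, hR, ← map_pow,
    FiniteField.pow_card, sub_self]

variable {D : Type*} [DivisionRing D]

/-- Over a finite field, an element `w` of finite order that conjugates a finite-dimensional
subalgebra `S` into itself commutes with `S`: the product of `S` and `k[w]` is a finite domain,
hence commutative by Wedderburn's little theorem. -/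
theorem mul_comm_of_pow_eq_one_of_conj {k : Type*} [Field k] [Finite k] [Algebra k D]
    (S : Subalgebra k D) [Module.Finite k S] {w : D} {s : ℕ} (hs : 0 < s) (hw : w ^ s = 1)
    (hwS : ∀ x ∈ S, ∃ x' ∈ S, w * x = x' * w) {x : D} (hx : x ∈ S) : w * x = x * w := by
  let W := Algebra.adjoin k {w}
  have hint : IsIntegral k w :=
    ⟨Polynomial.X ^ s - 1, Polynomial.monic_X_pow_sub_C 1 hs.ne', by simp [hw]⟩
  have hWfg : W.toSubmodule.FG := hint.fg_adjoin_singleton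
  have hSfg : S.toSubmodule.FG := Module.Finite.iff_fg.1 ‹_›
  have hpow (j : ℕ) : ∀ x ∈ S, ∃ x' ∈ S, w ^ j * x = x' * w ^ j := by
    induction j with
    | zero => exact fun x hx => ⟨x, hx, by simp⟩
    | succ j ih =>
      intro x hx
      obtain ⟨x₁, hx₁, h₁⟩ := hwS x hx
      obtain ⟨x₂, hx₂, h₂⟩ := ih x₁ hx₁
      exact ⟨x₂, hx₂, by rw [pow_succ, mul_assoc, h₁, ← mul_assoc, h₂, mul_assoc]⟩
  have hcomm : W.toSubmodule * S.toSubmodule ≤ S.toSubmodule * W.toSubmodule := by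
    rw [Submodule.mul_le]
    intro u hu x hx
    have hu : u ∈ Algebra.adjoin k {w} := hu
    rw [Algebra.adjoin_singleton_eq_range_aeval] at hu
    obtain ⟨p, rfl⟩ := hu
    change Polynomial.aeval w p * x ∈ _
    rw [Polynomial.aeval_eq_sum_range, Finset.sum_mul]
    refine Submodule.sum_mem _ fun i _ => ?_
    obtain ⟨x', hx', h'⟩ := hpow i x hx
    rw [smul_mul_assoc, h']
    exact Submodule.smul_mem _ _
      (Submodule.mul_mem_mul hx' (pow_mem (Algebra.self_mem_adjoin_singleton k w) i))
  have hmem {u v : D} (hu : u ∈ S) (hv : v ∈ W) : u * v ∈ S.toSubmodule * W.toSubmodule :=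
    Submodule.mul_mem_mul ((Subalgebra.mem_toSubmodule S).2 hu)
      ((Subalgebra.mem_toSubmodule W).2 hv)
  let T : Subalgebra k D := (S.toSubmodule * W.toSubmodule).toSubalgebra
    (by simpa using hmem S.one_mem W.one_mem) fun u v hu hv => by
      have h1 := Submodule.mul_mem_mul hu hv
      have h2 : (S.toSubmodule * W.toSubmodule) * (S.toSubmodule * W.toSubmodule) ≤
          S.toSubmodule * W.toSubmodule := calc
        _ = S.toSubmodule * (W.toSubmodule * S.toSubmodule) * W.toSubmodule := by
          simp only [mul_assoc]
        _ ≤ S.toSubmodule * (S.toSubmodule * W.toSubmodule) * W.toSubmodule := by gcongr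
        _ = (S.toSubmodule * S.toSubmodule) * (W.toSubmodule * W.toSubmodule) := by
          simp only [mul_assoc]
        _ ≤ _ := by
          rw [S.isIdempotentElem_toSubmodule.eq, W.isIdempotentElem_toSubmodule.eq]
      exact h2 h1
  have hTfin : Module.Finite k T := Module.Finite.iff_fg.2 (hSfg.mul hWfg)
  have : Finite T := Module.finite_of_finite k
  have hwT : w ∈ T := by
    have := hmem S.one_mem (Algebra.self_mem_adjoin_singleton k w)
    rwa [one_mul] at this
  have hxT : x ∈ T := by
    have := hmem hx W.one_mem
    rwa [mul_one] at this
  exact congrArg Subtype.val ((Finite.isDomain_to_isField T).mul_comm ⟨w, hwT⟩ ⟨x, hxT⟩)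

/-- The centralizer of an element, as a division subring. -/
def Subfield.centralizerSingleton (u : D) : Subfield D where
  __ := Subring.centralizer {u}
  inv_mem' _ hx := Set.inv_mem_centralizer₀ hx

theorem Subfield.mem_centralizerSingleton {u x : D} :
    x ∈ Subfield.centralizerSingleton u ↔ u * x = x * u := by
  change x ∈ Subring.centralizer {u} ↔ _
  simp [Subring.mem_centralizer_iff]

/-- An element `a` of finite order that is not central in `D` lies, as a noncentral element, in a
division subring with infinite center. If the center of `D` is finite, this division subring is the
centralizer of a power of an element conjugating `a` to another element of the finite field
generated by `a`. -/
theorem exists_subfield_infinite_center {a : D} {m : ℕ} (hm : 0 < m) (ham : a ^ m = 1)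
    (ha : a ∉ Subring.center D) :
    ∃ K : Subfield D, ∃ b : K, (b : D) = a ∧ b ∉ Subring.center K ∧
      Infinite (Subring.center K) := by
  by_cases hinf : Infinite (Subring.center D)
  · refine ⟨⊤, ⟨a, Subfield.mem_top a⟩, rfl, fun h => ha ?_, ?_⟩
    · rw [Subring.mem_center_iff] at h ⊢
      exact fun g => congrArg Subtype.val (h ⟨g, Subfield.mem_top g⟩)
    · refine Infinite.of_injective (fun t : Subring.center D =>
        (⟨⟨t, Subfield.mem_top _⟩, ?_⟩ : Subring.center (⊤ : Subfield D))) ?_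
      · exact Subring.mem_center_iff.2 fun g => Subtype.ext (Subring.mem_center_iff.1 t.2 g)
      · intro s t h
        exact Subtype.ext (congrArg (fun x : Subring.center (⊤ : Subfield D) =>
          ((x : (⊤ : Subfield D)) : D)) h)
  rw [not_infinite_iff_finite] at hinf
  let k := Subring.center D
  let S := Algebra.adjoin k {a}
  have hint : IsIntegral k a :=
    ⟨Polynomial.X ^ m - 1, Polynomial.monic_X_pow_sub_C 1 hm.ne', by simp [ham]⟩
  have : Module.Finite k S := Module.Finite.iff_fg.2 hint.fg_adjoin_singleton
  have : Finite S := Module.finite_of_finite k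
  cases nonempty_fintype S
  classical
  let _ : DivisionRing S := Fintype.divisionRingOfIsDomain S
  let _ : Field S := littleWedderburn S
  have haS : a ∈ S := Algebra.self_mem_adjoin_singleton k a
  obtain ⟨y, hy⟩ : ∃ y, y * a ≠ a * y := by
    simpa [Subring.mem_center_iff] using ha
  obtain ⟨e, hea, w, hw0, hwa⟩ :=
    exists_mul_eq_mul_ne_of_finite (S.val : S →+* D) (a := ⟨a, haS⟩) (y := y) hy
  have hwa : w * a = e * w := hwa
  have hea : (e : D) ≠ a := fun h => hea (Subtype.ext h)
  have hwne : w * a ≠ a * w := fun h => hea (mul_right_cancel₀ hw0 (hwa.symm.trans h))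
  have hwS : ∀ x ∈ S, ∃ x' ∈ S, w * x = x' * w := by
    intro x hx
    refine Algebra.adjoin_induction (p := fun x _ => ∃ x' ∈ S, w * x = x' * w) ?_ ?_ ?_ ?_ hx
    · rintro _ rfl
      exact ⟨e, e.2, hwa⟩
    · exact fun r => ⟨_, S.algebraMap_mem r, (Algebra.commutes r w).symm⟩
    · rintro x y - - ⟨x', hx', h⟩ ⟨y', hy', h'⟩
      exact ⟨x' + y', add_mem hx' hy', by rw [mul_add, h, h', add_mul]⟩
    · rintro x y - - ⟨x', hx', h⟩ ⟨y', hy', h'⟩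
      exact ⟨x' * y', mul_mem hx' hy', by rw [← mul_assoc, h, mul_assoc, h', mul_assoc]⟩
  have hwnt (s : ℕ) (hs : 0 < s) : w ^ s ≠ 1 := fun h =>
    hwne (mul_comm_of_pow_eq_one_of_conj S hs h hwS haS)
  -- some power of `w` commutes with `a`, since `a` has finitely many conjugates under these powers
  obtain ⟨s, hs, hsa⟩ : ∃ s, 0 < s ∧ Commute (w ^ s) a := by
    have hpow (j : ℕ) : ∃ x' : S, w ^ j * a = x' * w ^ j := by
      induction j with
      | zero => exact ⟨⟨a, haS⟩, by simp⟩
      | succ j ih =>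
        obtain ⟨x₁, h₁⟩ := ih
        obtain ⟨x₂, hx₂, h₂⟩ := hwS x₁ x₁.2
        exact ⟨⟨x₂, hx₂⟩, by rw [pow_succ', mul_assoc, h₁, ← mul_assoc, h₂, mul_assoc]⟩
    choose f hf using hpow
    obtain ⟨i, j, hij, hfij⟩ : ∃ i j, i < j ∧ f i = f j := by
      obtain ⟨i, j, hne, h⟩ := Finite.exists_ne_map_eq_of_infinite f
      rcases lt_or_gt_of_ne hne with h' | h'
      · exact ⟨i, j, h', h⟩
      · exact ⟨j, i, h', h.symm⟩
    refine ⟨j - i, by omega, mul_left_cancel₀ (pow_ne_zero i hw0) ?_⟩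
    rw [← mul_assoc, ← mul_assoc, ← pow_add, Nat.add_sub_cancel' hij.le, hf j, hf i, ← hfij,
      mul_assoc, ← pow_add, Nat.add_sub_cancel' hij.le]
  let K := Subfield.centralizerSingleton (w ^ s)
  have haK : a ∈ K := Subfield.mem_centralizerSingleton.2 hsa
  have hwK : w ∈ K := Subfield.mem_centralizerSingleton.2 ((Commute.refl w).pow_left s)
  refine ⟨K, ⟨a, haK⟩, rfl, fun h => ?_, ?_⟩
  · exact hwne (congrArg Subtype.val (Subring.mem_center_iff.1 h ⟨w, hwK⟩))
  · have hmem (j : ℕ) : (⟨w, hwK⟩ : K) ^ (s * j) ∈ Subring.center K := by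
      rw [pow_mul]
      refine pow_mem (Subring.mem_center_iff.2 fun g => Subtype.ext ?_) j
      exact (Subfield.mem_centralizerSingleton.1 g.2).symm
    refine Infinite.of_injective (fun j : ℕ => (⟨_, hmem j⟩ : Subring.center K)) ?_
    have hlt (i j : ℕ) (hij : i < j) : w ^ (s * i) ≠ w ^ (s * j) := by
      intro h
      refine hwnt (s * (j - i)) (Nat.mul_pos hs (by omega)) ?_
      rw [← Nat.add_sub_cancel' hij.le, mul_add, pow_add] at h
      simpa using (left_eq_mul₀ (pow_ne_zero _ hw0)).1 h
    intro i j h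
    have h : w ^ (s * i) = w ^ (s * j) := by
      simpa using congrArg (fun x : Subring.center K => ((x : K) : D)) h
    by_contra hne
    rcases lt_or_gt_of_ne hne with h' | h'
    · exact hlt i j h' h
    · exact hlt j i h' h.symm

/-- An almost subnormal subgroup of `Dˣ` that is finite modulo the center is central. -/
theorem Subgroup.IsAlmostSubnormal.le_center {H : Subgroup Dˣ} (hH : H.IsAlmostSubnormal)
    (hfin : (Subgroup.center Dˣ).relIndex H ≠ 0) : H ≤ Subgroup.center Dˣ := by
  by_cases hinf : Infinite (Subring.center D)
  · exact hH.le_center_of_infinite_center hfin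
  rw [not_infinite_iff_finite] at hinf
  have hZ : Finite (Subgroup.center Dˣ) :=
    Finite.of_injective (fun u : Subgroup.center Dˣ =>
      (⟨(u : Dˣ), Units.mem_center_iff_coe_mem.1 u.2⟩ : Subring.center D)) fun u v h =>
        Subtype.ext (Units.ext (congrArg Subtype.val h))
  have hHfin : Finite H := by
    have : (⊥ : Subgroup Dˣ).relIndex H ≠ 0 := Subgroup.relIndex_ne_zero_trans
      (by rw [Subgroup.relIndex_bot_left]; exact Nat.card_pos.ne') hfin
    rw [Subgroup.relIndex_bot_left] at this
    exact Nat.finite_of_card_ne_zero this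
  intro a haH
  by_contra hac
  rw [Units.mem_center_iff_coe_mem] at hac
  obtain ⟨m, hm, ham⟩ := (isOfFinOrder_of_finite (⟨a, haH⟩ : H)).exists_pow_eq_one
  obtain ⟨K, b, hba, hb, hKinf⟩ := exists_subfield_infinite_center hm
    (by simpa using congrArg (fun x : H => ((x : Dˣ) : D)) ham) hac
  let f : Kˣ →* Dˣ := Units.map K.subtype
  have hf : Function.Injective f := Units.map_injective K.subtype.injective
  have : Finite (H.comap f) :=
    Finite.of_injective (fun x : H.comap f => (⟨f x, x.2⟩ : H)) fun x y h =>
      Subtype.ext (hf (congrArg Subtype.val h))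
  have hle := (hH.comap f).le_center_of_infinite_center
    (ne_zero_of_dvd_ne_zero Nat.card_pos.ne' (Subgroup.relIndex_dvd_card _ _))
  have hb0 : b ≠ 0 := by
    rintro rfl
    exact a.ne_zero hba.symm
  have hfb : f (Units.mk0 b hb0) = a := Units.ext hba
  exact hb (Units.mem_center_iff_coe_mem.1 (hle (show f (Units.mk0 b hb0) ∈ H from hfb ▸ haH)))

end FiniteCenter

theorem proposition2p2 {D : Type*} [DivisionRing D] (G : Subgroup Dˣ)
    (hG : G.IsAlmostSubnormal) (hnc : G.IsNonCentral) :
    ∃ N : Subgroup Dˣ, N ≤ G ∧ N.IsSubnormal ∧ N.IsNonCentral := by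
  obtain ⟨N, hNG, hN, hfin⟩ := hG.exists_isSubnormal_relIndex_ne_zero
  refine ⟨N, hNG, hN, Subgroup.isNonCentral_iff.2 fun hNc => ?_⟩
  exact Subgroup.isNonCentral_iff.1 hnc
    (hG.le_center fun h0 => hfin (Subgroup.relIndex_eq_zero_of_le_left hNc h0))
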